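/- Let $d\in\mathbb{N}$, let $C:\mathbb{R}^d\times\mathbb{R}^d\to\mathbb{C}$ and $C_0:\mathbb{R}^d\to\mathbb{C}$ satisfy $C(x,y)=C_0(x-y)$ for all $x,y\in\mathbb{R}^d$. Consider the following conditions. (C1) $C$ is a continuous complex covariance function, i.e. $C$ is continuous and for all $n$ and all $x_1,\dots,x_n\in\mathbb{R}^d$ the matrix $(C(x_i,x_j))_{i,j=1}^n$ is Hermitian and positive semidefinite. (C2) For every compact set $S\subset\mathbb{R}^d$, every eigenvalue $\lambda$ of the integral operator $h\mapsto\int_S C(\cdot,y)\,h(y)\,\mathrm{d}y$ on $L^2(S)$ satisfies $\lambda\le 1$ (under (C1) these eigenvalues are real). Then the following two statements are equivalent. (i) There exists $\varphi\in L^1(\mathbb{R}^d)$ with $0\le\varphi\le 1$ and $C_0=\mathcal{F}^{-1}(\varphi)$, i.e. $C_0(x)=\int_{\mathbb{R}^d}\varphi(y)\,\mathrm{e}^{2\pi\mathrm{i}\,x\cdot y}\,\mathrm{d}y$ for all $x\in\mathbb{R}^d$. (ii) Conditions (C1) and (C2) hold and $C_0\in L^2(\mathbb{R}^d)$. -/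

import Mathlib

open MeasureTheory
open scoped FourierTransform ComplexOrder

namespace DPP

/-- The `n × n` matrix `[C](x₁, …, xₙ)` with entries `C(xᵢ, xⱼ)`. -/
def kernelMatrix {E : Type*} (C : E → E → ℂ) {n : ℕ} (x : Fin n → E) :
    Matrix (Fin n) (Fin n) ℂ :=
  Matrix.of fun i j => C (x i) (x j)

/-- A complex covariance function: a Hermitian, non-negative definite kernel
(`Matrix.PosSemidef` includes being Hermitian). -/
def IsCovarianceFunction {E : Type*} (C : E → E → ℂ) : Prop :=
  ∀ (n : ℕ) (x : Fin n → E), (kernelMatrix C x).PosSemidef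

/-- Condition (C1): `C` is a continuous complex covariance function. -/
def CondC1 {d : ℕ} (C : EuclideanSpace ℝ (Fin d) → EuclideanSpace ℝ (Fin d) → ℂ) : Prop :=
  Continuous (fun p : EuclideanSpace ℝ (Fin d) × EuclideanSpace ℝ (Fin d) => C p.1 p.2) ∧
    IsCovarianceFunction C

/-- `c` is an eigenvalue of the integral operator `h ↦ ∫_S C(·, y) h(y) dy` on `L²(S)`:
there is an eigenfunction `h ∈ L²(S)`, not almost everywhere zero on `S`. -/
def IsKernelEigenvalue {d : ℕ} (C : EuclideanSpace ℝ (Fin d) → EuclideanSpace ℝ (Fin d) → ℂ)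
    (S : Set (EuclideanSpace ℝ (Fin d))) (c : ℂ) : Prop :=
  ∃ h : EuclideanSpace ℝ (Fin d) → ℂ,
    MemLp h 2 (volume.restrict S) ∧
    ¬ (∀ᵐ x ∂(volume.restrict S), h x = 0) ∧
    ∀ᵐ x ∂(volume.restrict S), ∫ y in S, C x y * h y = c * h x

/-- Condition (C2): for every compact `S`, all eigenvalues of the kernel `C` on `S` are at most
one. (Under (C1) the integral operator is self-adjoint, so all its eigenvalues are real.) -/
def CondC2 {d : ℕ} (C : EuclideanSpace ℝ (Fin d) → EuclideanSpace ℝ (Fin d) → ℂ) : Prop :=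
  ∀ S : Set (EuclideanSpace ℝ (Fin d)), IsCompact S →
    ∀ c : ℝ, IsKernelEigenvalue C S (c : ℂ) → c ≤ 1

end DPP

/-! Everything rests on one identity: for a stationary kernel with spectral density `φ`, the
quadratic form `∫∫ conj (f x) C₀(x - y) f(y)` equals `∫ φ |𝓕 f|²`. By Plancherel, `0 ≤ φ ≤ 1` says
that this form lies between `0` and `‖f‖₂²`. Condition (C1) is the lower bound on finite sums of
point masses; (C2) is the upper bound on functions supported in compact sets.

From the density to the kernel: finite quadratic forms are integrals of `φ` against a squared
modulus (`isCovarianceFunction_fourierInv`). An eigenfunction `h` on `S`, extended by zero, gives `c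
‖h‖² = ∫ φ |𝓕 h|² ≤ ‖h‖²` (`condC2_fourierInv`). Square integrability of `C₀` is that of `φ`,
transported by the `L²` Fourier transform.

From the kernel to the density: no appeal to Bochner's theorem is needed, since `C₀ ∈ L²` already
has a Fourier transform `Φ` in `L²`. Simple function approximation turns (C1) into nonnegativity of
the form on `L¹` (`IsCovarianceFunction.integral_nonneg`). On a compact set the integral operator is
positive and compact, so its norm is its largest eigenvalue and (C2) makes it a contraction;
exhausting the space by balls gives the global upper bound (`norm_integral_kernel_le`). Taking `f =
𝓕⁻ g` for a test function `g` gives `∫ g² Φ` (`exists_integral_sq_mul_fourier_eq`), so `0 ≤ Φ ≤ 1`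
almost everywhere. Integrability of `Φ` follows from Gaussian means bounded by `sup |C₀|` and
Fatou's lemma (`integrable_spectralDensity`). Fourier inversion in `L²` and continuity then recover
`C₀` at every point. -/

namespace DPP

/-! ### Duality for Fourier integrals, and their agreement with the `L²` Fourier transform. -/

section FourierL2

open Filter Topology ComplexConjugate

variable {V : Type*} [NormedAddCommGroup V] [InnerProductSpace ℝ V] [FiniteDimensional ℝ V]
  [MeasurableSpace V] [BorelSpace V]

/-- An integrable function bounded by a constant is square integrable. -/
lemma memLp_two_of_integrable_of_bound {α : Type*} [MeasurableSpace α] {μ : Measure α}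
    {f : α → ℂ} (hf : Integrable f μ) {M : ℝ} (hM : ∀ x, ‖f x‖ ≤ M) : MemLp f 2 μ := by
  rw [memLp_two_iff_integrable_sq_norm hf.aestronglyMeasurable]
  refine (hf.norm.const_mul M).mono' (hf.aestronglyMeasurable.norm.pow 2) ?_
  filter_upwards with x
  rw [Real.norm_of_nonneg (by positivity), sq]
  exact mul_le_mul_of_nonneg_right (hM x) (norm_nonneg _)

lemma continuous_fourier {f : V → ℂ} (hf : Integrable f) : Continuous (𝓕 f) :=
  VectorFourier.fourierIntegral_continuous Real.continuous_fourierChar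
    (by exact continuous_inner) hf

lemma continuous_fourierInv {f : V → ℂ} (hf : Integrable f) : Continuous (𝓕⁻ f) := by
  have : (𝓕⁻ f : V → ℂ) = fun x => 𝓕 f (-x) := by
    ext x; rw [Real.fourierInv_eq_fourier_neg]
  rw [this]
  exact (continuous_fourier hf).comp continuous_neg

lemma integral_fourier_mul_eq {f g : V → ℂ} (hf : Integrable f) (hg : Integrable g) :
    ∫ ξ, 𝓕 f ξ * g ξ = ∫ x, f x * 𝓕 g x := by
  simpa using! VectorFourier.integral_fourierIntegral_smul_eq_flip (L := innerₗ V)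
    Real.continuous_fourierChar continuous_inner hf hg

lemma integral_fourierInv_mul_eq {f g : V → ℂ} (hf : Integrable f) (hg : Integrable g) :
    ∫ ξ, 𝓕⁻ f ξ * g ξ = ∫ x, f x * 𝓕⁻ g x := by
  have := integral_fourier_mul_eq hf hg.comp_neg
  rw [← integral_neg_eq_self] at this
  simp only [neg_neg, ← Real.fourierInv_eq_fourier_neg, ← Real.fourierInv_eq_fourier_comp_neg]
    at this
  exact this

/-- The adjoint of the Fourier transform is its inverse. This form yields both the autocorrelation
identity and the spectral form of the kernel. -/
lemma integral_conj_fourier_mul_eq {f g : V → ℂ} (hf : Integrable f) (hg : Integrable g) :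
    ∫ ξ, conj (𝓕 f ξ) * g ξ = ∫ x, conj (f x) * 𝓕⁻ g x := by
  have := VectorFourier.integral_sesq_fourierIntegral_eq_neg_flip (innerSL ℂ)
    (L := innerₗ V) Real.continuous_fourierChar continuous_inner hf hg
  simp only [innerSL_apply_apply, RCLike.inner_apply'] at this
  simpa using! this

/-- Multiplication formula for the Fourier transform on `L²`, tested against a Schwartz function. -/
lemma integral_mul_fourier_Lp_eq (f : Lp ℂ 2 (volume : Measure V)) (g : SchwartzMap V ℂ) :
    ∫ x, g x * (𝓕 f : Lp ℂ 2 (volume : Measure V)) x = ∫ x, 𝓕 (g : V → ℂ) x * f x := by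
  have := congrArg (fun T => T g) (Lp.fourier_toTemperedDistribution_eq f)
  simp only [TemperedDistribution.fourier_apply, Lp.toTemperedDistribution_apply,
    smul_eq_mul] at this
  rw [← this]
  rfl

lemma integral_mul_fourierInv_Lp_eq (f : Lp ℂ 2 (volume : Measure V)) (g : SchwartzMap V ℂ) :
    ∫ x, g x * (𝓕⁻ f : Lp ℂ 2 (volume : Measure V)) x = ∫ x, 𝓕⁻ (g : V → ℂ) x * f x := by
  have := congrArg (fun T => T g) (Lp.fourierInv_toTemperedDistribution_eq f)
  simp only [TemperedDistribution.fourierInv_apply, Lp.toTemperedDistribution_apply,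
    smul_eq_mul] at this
  rw [← this, SchwartzMap.fourierInv_coe]

/-- On `L¹ ∩ L²` the Fourier transform on `L²` is given by the Fourier integral. -/
lemma fourier_toLp_ae_eq {f : V → ℂ} (hf : Integrable f) (hf2 : MemLp f 2) :
    (𝓕 (hf2.toLp f) : Lp ℂ 2 (volume : Measure V)) =ᵐ[volume] 𝓕 f := by
  -- Both sides are locally integrable, hence determined by pairings with smooth bumps; the two
  -- multiplication formulas move the transform onto the bump, where they agree.
  refine ae_eq_of_integral_contDiff_smul_eq
    ((Lp.memLp _).locallyIntegrable (by norm_num)) (continuous_fourier hf).locallyIntegrable ?_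
  intro g hg hgc
  have hgc' : HasCompactSupport (fun x => (g x : ℂ)) := hgc.comp_left (g := Complex.ofReal) rfl
  have hg' : ContDiff ℝ ((⊤ : ℕ∞) : WithTop ℕ∞) (fun x => (g x : ℂ)) := Complex.ofRealCLM.contDiff.comp hg
  have h1 := integral_mul_fourier_Lp_eq (hf2.toLp f) (hgc'.toSchwartzMap hg')
  have h2 := integral_fourier_mul_eq (hgc'.toSchwartzMap hg').integrable hf
  have h3 : ∫ x, 𝓕 (hgc'.toSchwartzMap hg' : V → ℂ) x * hf2.toLp f x =
      ∫ x, 𝓕 (hgc'.toSchwartzMap hg' : V → ℂ) x * f x := by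
    refine integral_congr_ae ?_
    filter_upwards [hf2.coeFn_toLp] with x hx
    rw [hx]
  simp only [Complex.real_smul]
  exact h1.trans (h3.trans h2)

lemma fourierInv_toLp_ae_eq {f : V → ℂ} (hf : Integrable f) (hf2 : MemLp f 2) :
    (𝓕⁻ (hf2.toLp f) : Lp ℂ 2 (volume : Measure V)) =ᵐ[volume] 𝓕⁻ f := by
  refine ae_eq_of_integral_contDiff_smul_eq
    ((Lp.memLp _).locallyIntegrable (by norm_num)) (continuous_fourierInv hf).locallyIntegrable ?_
  intro g hg hgc
  have hgc' : HasCompactSupport (fun x => (g x : ℂ)) := hgc.comp_left (g := Complex.ofReal) rfl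
  have hg' : ContDiff ℝ ((⊤ : ℕ∞) : WithTop ℕ∞) (fun x => (g x : ℂ)) := Complex.ofRealCLM.contDiff.comp hg
  have h1 := integral_mul_fourierInv_Lp_eq (hf2.toLp f) (hgc'.toSchwartzMap hg')
  have h2 := integral_fourierInv_mul_eq (hgc'.toSchwartzMap hg').integrable hf
  have h3 : ∫ x, 𝓕⁻ (hgc'.toSchwartzMap hg' : V → ℂ) x * hf2.toLp f x =
      ∫ x, 𝓕⁻ (hgc'.toSchwartzMap hg' : V → ℂ) x * f x := by
    refine integral_congr_ae ?_
    filter_upwards [hf2.coeFn_toLp] with x hx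
    rw [hx]
  simp only [Complex.real_smul]
  exact h1.trans (h3.trans h2)

lemma integral_norm_sq_eq_norm_toLp_sq {α : Type*} [MeasurableSpace α] {μ : Measure α}
    {f : α → ℂ} (hf : MemLp f 2 μ) : ∫ x, ‖f x‖ ^ 2 ∂μ = ‖hf.toLp f‖ ^ 2 := by
  have h := inner_self_eq_norm_sq_to_K (𝕜 := ℂ) (hf.toLp f)
  rw [L2.inner_def] at h
  have h2 : ∫ x, inner ℂ (hf.toLp f x) (hf.toLp f x) ∂μ = ∫ x, ((‖f x‖ ^ 2 : ℝ) : ℂ) ∂μ := by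
    refine integral_congr_ae ?_
    filter_upwards [hf.coeFn_toLp] with x hx
    rw [hx, inner_self_eq_norm_sq_to_K]
    norm_cast
  rw [h2, integral_complex_ofReal, ← RCLike.ofReal_pow] at h
  exact Complex.ofReal_injective h

/-- Plancherel's theorem for `f ∈ L¹ ∩ L²`. -/
lemma integral_norm_sq_fourier_eq {f : V → ℂ} (hf : Integrable f) (hf2 : MemLp f 2) :
    MemLp (𝓕 f) 2 ∧ ∫ ξ, ‖𝓕 f ξ‖ ^ 2 = ∫ x, ‖f x‖ ^ 2 := by
  have hae := fourier_toLp_ae_eq hf hf2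
  have hmem : MemLp (𝓕 f) 2 := (memLp_congr_ae hae).1 (Lp.memLp _)
  refine ⟨hmem, ?_⟩
  rw [integral_norm_sq_eq_norm_toLp_sq hmem, integral_norm_sq_eq_norm_toLp_sq hf2,
    ← Lp.norm_fourier_eq (hf2.toLp f)]
  congr 2
  exact Lp.ext (hmem.coeFn_toLp.trans hae.symm)

end FourierL2

/-! ### From finite positive semidefinite matrices to nonnegative integral forms. -/

section PositiveDefinite

open Filter Topology ComplexConjugate

variable {E : Type*} {K : E → E → ℂ}

/-- Indexing by the points themselves lets the range of a simple function serve as the index set. -/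
lemma IsCovarianceFunction.sum_nonneg (hK : IsCovarianceFunction K) (s : Finset E) (c : E → ℂ) :
    0 ≤ ∑ a ∈ s, ∑ b ∈ s, conj (c a) * K a b * c b := by
  have h := (Matrix.posSemidef_iff_dotProduct_mulVec.1
    (hK s.card fun i => (s.equivFin.symm i : E))).2 fun i => c (s.equivFin.symm i)
  simp only [dotProduct, Matrix.mulVec, kernelMatrix, Matrix.of_apply, Pi.star_apply,
    Finset.mul_sum] at h
  refine h.trans_eq ?_
  rw [← Finset.sum_coe_sort s, ← s.equivFin.symm.sum_comp]
  refine Finset.sum_congr rfl fun i _ => ?_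
  rw [← Finset.sum_coe_sort s, ← s.equivFin.symm.sum_comp]
  refine Finset.sum_congr rfl fun j _ => ?_
  rw [mul_assoc]
  rfl

lemma IsCovarianceFunction.star_apply (hK : IsCovarianceFunction K) (x y : E) :
    conj (K x y) = K y x :=
  (hK 2 ![x, y]).1.apply 1 0

/-- A stationary covariance function is bounded by its value at the origin. -/
lemma IsCovarianceFunction.norm_le_of_stationary [AddGroup E] {C₀ : E → ℂ}
    (hK : IsCovarianceFunction K) (hstat : ∀ x y, K x y = C₀ (x - y)) (x : E) :
    ‖C₀ x‖ ≤ (C₀ 0).re := by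
  have h0 : 0 ≤ C₀ 0 := by
    simpa [hstat] using hK.sum_nonneg {0} (fun _ => 1)
  -- The determinant at the points `x, 0` is `C₀(0)² - |C₀(x)|²`.
  have hdet := (hK 2 ![x, 0]).det_nonneg
  have hs := hK.star_apply x 0
  simp only [hstat, sub_zero] at hs
  simp only [kernelMatrix, Matrix.det_fin_two, Matrix.of_apply, Matrix.cons_val_zero,
    Matrix.cons_val_one, hstat, sub_self, sub_zero] at hdet
  rw [← hs, Complex.mul_conj'] at hdet
  rw [Complex.le_def] at h0 hdet
  have him : (C₀ 0).im = 0 := h0.2.symm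
  have h1 := hdet.1
  simp only [Complex.zero_re, Complex.sub_re, Complex.mul_re, him, ← Complex.ofReal_pow,
    Complex.ofReal_re] at h1
  refine abs_le_of_sq_le_sq' ?_ h0.1 |>.2
  nlinarith

variable [MeasurableSpace E] {μ : Measure E}

lemma integral_simpleFunc_comp_mul (π : SimpleFunc E E) (G : E → ℂ) {f : E → ℂ}
    (hf : Integrable f μ) :
    ∫ y, G (π y) * f y ∂μ = ∑ b ∈ π.range, G b * ∫ y in π ⁻¹' {b}, f y ∂μ := by
  have h : ∀ y, G (π y) * f y = ∑ b ∈ π.range, G b * (π ⁻¹' {b}).indicator f y := by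
    intro y
    rw [Finset.sum_eq_single (π y)]
    · simp
    · intro b _ hb
      simp [Set.indicator, hb.symm]
    · intro h
      exact absurd (π.mem_range_self y) h
  simp_rw [h]
  rw [integral_finsetSum]
  · refine Finset.sum_congr rfl fun b _ => ?_
    rw [integral_const_mul, integral_indicator (π.measurableSet_preimage _)]
  · intro b _
    exact (hf.indicator (π.measurableSet_preimage _)).const_mul _

/-- Collapsing each fibre of `π` to its value leaves a finite quadratic form, with coefficients the
integrals of `f` over the fibres. -/
lemma IsCovarianceFunction.integral_simpleFunc_nonneg (hK : IsCovarianceFunction K)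
    (π : SimpleFunc E E) {f : E → ℂ} (hf : Integrable f μ) :
    0 ≤ ∫ x, ∫ y, conj (f x) * K (π x) (π y) * f y ∂μ ∂μ := by
  have h1 : ∀ x, ∫ y, conj (f x) * K (π x) (π y) * f y ∂μ =
      (∑ b ∈ π.range, K (π x) b * ∫ y in π ⁻¹' {b}, f y ∂μ) * conj (f x) := by
    intro x
    rw [← integral_simpleFunc_comp_mul π (K (π x)) hf, mul_comm, ← integral_const_mul]
    simp only [mul_assoc]
  have hfc : Integrable (fun x => conj (f x)) μ :=
    (LinearIsometryEquiv.integrable_comp_iff Complex.conjLIE).2 hf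
  simp_rw [h1]
  rw [integral_simpleFunc_comp_mul π
    (fun a => ∑ b ∈ π.range, K a b * ∫ y in π ⁻¹' {b}, f y ∂μ) hfc]
  refine (hK.sum_nonneg π.range fun a => ∫ y in π ⁻¹' {a}, f y ∂μ).trans_eq ?_
  refine Finset.sum_congr rfl fun a _ => ?_
  rw [Finset.sum_mul, ← integral_conj]
  refine Finset.sum_congr rfl fun b _ => ?_
  ring

lemma integrable_conj_mul_kernel_mul [SFinite μ] {f : E → ℂ} (hf : Integrable f μ)
    (hKm : Measurable (Function.uncurry K)) {M : ℝ} (hM : ∀ x y, ‖K x y‖ ≤ M) :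
    Integrable (fun p : E × E => conj (f p.1) * K p.1 p.2 * f p.2) (μ.prod μ) := by
  have hfc : Integrable (fun x => conj (f x)) μ :=
    (LinearIsometryEquiv.integrable_comp_iff Complex.conjLIE).2 hf
  refine ((hfc.mul_prod hf).bdd_mul (c := M) hKm.aestronglyMeasurable
    (ae_of_all _ fun p => hM p.1 p.2)).congr (ae_of_all _ fun p => ?_)
  simp only [Function.uncurry]
  ring

/-- The quadratic form of a bounded continuous covariance function is nonnegative on `L¹`. -/
lemma IsCovarianceFunction.integral_nonneg [PseudoEMetricSpace E] [SecondCountableTopology E]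
    [OpensMeasurableSpace E] [SFinite μ] (hK : IsCovarianceFunction K)
    (hKc : Continuous (Function.uncurry K)) {M : ℝ} (hM : ∀ x y, ‖K x y‖ ≤ M)
    {f : E → ℂ} (hf : Integrable f μ) :
    0 ≤ ∫ x, ∫ y, conj (f x) * K x y * f y ∂μ ∂μ := by
  rcases isEmpty_or_nonempty E with hE | ⟨⟨x₀⟩⟩
  · simp [Measure.eq_zero_of_isEmpty μ]
  -- Simple functions converging pointwise to the identity. Continuity of `K` and the bound `M`
  -- allow dominated convergence on the product.
  let π : ℕ → SimpleFunc E E := fun n =>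
    SimpleFunc.approxOn id measurable_id Set.univ x₀ (Set.mem_univ _) n
  have hπ : ∀ x, Tendsto (fun n => π n x) atTop (𝓝 x) := fun x =>
    SimpleFunc.tendsto_approxOn measurable_id (Set.mem_univ x₀) (by simp)
  have hm : ∀ n, Measurable (Function.uncurry fun x y => K (π n x) (π n y)) := fun n =>
    hKc.measurable.comp (((π n).measurable.comp measurable_fst).prodMk
      ((π n).measurable.comp measurable_snd))
  have hint := fun n => integrable_conj_mul_kernel_mul hf (hm n) fun x y => hM (π n x) (π n y)
  have hint' := integrable_conj_mul_kernel_mul hf hKc.measurable hM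
  have hfc : Integrable (fun x => conj (f x)) μ :=
    (LinearIsometryEquiv.integrable_comp_iff Complex.conjLIE).2 hf
  have hlim : Tendsto (fun n => ∫ x, ∫ y, conj (f x) * K (π n x) (π n y) * f y ∂μ ∂μ) atTop
      (𝓝 (∫ x, ∫ y, conj (f x) * K x y * f y ∂μ ∂μ)) := by
    have hprod : ∀ n, ∫ x, ∫ y, conj (f x) * K (π n x) (π n y) * f y ∂μ ∂μ =
        ∫ p, conj (f p.1) * K (π n p.1) (π n p.2) * f p.2 ∂(μ.prod μ) := fun n =>
      (integral_prod _ (hint n)).symm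
    have hprod' : ∫ x, ∫ y, conj (f x) * K x y * f y ∂μ ∂μ =
        ∫ p, conj (f p.1) * K p.1 p.2 * f p.2 ∂(μ.prod μ) := (integral_prod _ hint').symm
    simp_rw [hprod, hprod']
    refine tendsto_integral_of_dominated_convergence
      (fun p : E × E => M * ‖conj (f p.1) * f p.2‖) (fun n => (hint n).aestronglyMeasurable)
      ((hfc.mul_prod hf).norm.const_mul M) (fun n => ae_of_all _ fun p => ?_)
      (ae_of_all _ fun p => ?_)
    · rw [norm_mul, norm_mul, norm_mul]
      nlinarith [mul_nonneg (norm_nonneg (conj (f p.1))) (norm_nonneg (f p.2)),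
        mul_le_mul_of_nonneg_right (hM (π n p.1) (π n p.2))
          (mul_nonneg (norm_nonneg (conj (f p.1))) (norm_nonneg (f p.2)))]
    · refine (Tendsto.const_mul _ ?_).mul_const _
      exact (hKc.tendsto (p.1, p.2)).comp ((hπ p.1).prodMk_nhds (hπ p.2))
  exact ge_of_tendsto' hlim fun n => hK.integral_simpleFunc_nonneg (π n) hf

end PositiveDefinite

/-! ### Integral operators on `L²` of a finite measure: existence, norm bounds, finite rank. -/

section IntegralOperator

open Filter Topology ComplexConjugate

/-- A positive compact operator all of whose real eigenvalues are at most one is a contraction. -/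
lemma norm_le_one_of_eigenvalue_le_one {H : Type*} [NormedAddCommGroup H] [InnerProductSpace ℂ H]
    [CompleteSpace H] {T : H →L[ℂ] H} (hc : IsCompactOperator T) (hpos : T.IsPositive)
    (h : ∀ c : ℝ, Module.End.HasEigenvalue (T : Module.End ℂ H) (c : ℂ) → c ≤ 1) : ‖T‖ ≤ 1 := by
  by_cases hT : T = 0
  · simp [hT]
  have : Nontrivial H := by
    by_contra hn
    rw [not_nontrivial_iff_subsingleton] at hn
    exact hT (ContinuousLinearMap.ext fun x => Subsingleton.elim _ _)
  -- For a self-adjoint operator the norm is the spectral radius, attained at some `z` in the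
  -- spectrum. Compactness makes `z ≠ 0` an eigenvalue, and positivity makes it real and
  -- nonnegative, so `z = ‖T‖`.
  obtain ⟨z, hz, hzT⟩ := spectrum.exists_nnnorm_eq_spectralRadius T
  rw [ContinuousLinearMap.spectralRadius_eq_nnnorm T hpos.isSelfAdjoint] at hzT
  have hzn : ‖z‖ = ‖T‖ := by
    have := ENNReal.coe_injective hzT
    exact congrArg NNReal.toReal this
  have hz0 : z ≠ 0 := by
    rw [← norm_ne_zero_iff, hzn]
    exact norm_ne_zero_iff.2 hT
  have hev := (hc.hasEigenvalue_iff_mem_spectrum hz0).2 hz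
  have hconj := hpos.isSymmetric.conj_eigenvalue_eq_self hev
  obtain ⟨r, rfl⟩ := Complex.conj_eq_iff_real.1 hconj
  have hr0 : 0 ≤ r := eigenvalue_nonneg_of_nonneg hev fun x => hpos.re_inner_nonneg_right x
  have := h r hev
  rwa [← hzn, Complex.norm_real, Real.norm_of_nonneg hr0]

lemma isCompactOperator_of_forall_mem {H : Type*} [NormedAddCommGroup H] [NormedSpace ℂ H]
    (T : H →L[ℂ] H) (W : Submodule ℂ H) [FiniteDimensional ℂ W] (h : ∀ x, T x ∈ W) :
    IsCompactOperator T := by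
  have : ProperSpace W := FiniteDimensional.proper ℂ W
  exact (isCompactOperator_of_locallyCompactSpace_dom (T.codRestrict W h)).clm_comp W.subtypeL

variable {E : Type*} [MeasurableSpace E] {μ : Measure E} [IsFiniteMeasure μ] {K : E → E → ℂ}

/-- `T` is the integral operator on `L²(μ)` with kernel `K`. -/
def IsIntegralOperator (K : E → E → ℂ) (T : Lp ℂ 2 μ →L[ℂ] Lp ℂ 2 μ) : Prop :=
  ∀ f : Lp ℂ 2 μ, T f =ᵐ[μ] fun x => ∫ y, K x y * f y ∂μ

lemma integrable_of_Lp_two (f : Lp ℂ 2 μ) : Integrable f μ :=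
  (Lp.memLp f).integrable (by norm_num)

lemma integral_norm_le_mul_norm (f : Lp ℂ 2 μ) :
    ∫ x, ‖f x‖ ∂μ ≤ (μ Set.univ ^ (1 / 2 : ℝ)).toReal * ‖f‖ := by
  rw [integral_norm_eq_lintegral_enorm (Lp.aestronglyMeasurable f), ← eLpNorm_one_eq_lintegral_enorm,
    Lp.norm_def, mul_comm, ← ENNReal.toReal_mul]
  refine ENNReal.toReal_mono ?_ ?_
  · exact ENNReal.mul_ne_top (Lp.eLpNorm_ne_top f)
      (ENNReal.rpow_ne_top_of_nonneg (by norm_num) (measure_ne_top μ _))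
  · refine (eLpNorm_le_eLpNorm_mul_rpow_measure_univ (p := 1) (q := 2) (by norm_num)
      (Lp.aestronglyMeasurable f)).trans_eq ?_
    norm_num

lemma norm_integral_kernel_mul_le (f : Lp ℂ 2 μ) {k : E → ℂ} {M : ℝ}
    (hM : ∀ᵐ y ∂μ, ‖k y‖ ≤ M) :
    ‖∫ y, k y * f y ∂μ‖ ≤ M * ∫ y, ‖f y‖ ∂μ := by
  rw [← integral_const_mul]
  refine norm_integral_le_of_norm_le ((integrable_of_Lp_two f).norm.const_mul M) ?_
  filter_upwards [hM] with y hy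
  rw [norm_mul]
  exact mul_le_mul_of_nonneg_right hy (norm_nonneg _)

/-- Cauchy–Schwarz on a finite measure. `D` is chosen before the kernel, so uniformly close kernels
give operators close in norm; an almost everywhere bound suffices, which permits estimates valid
only on `S`. -/
lemma exists_norm_le_of_isIntegralOperator (μ : Measure E) [IsFiniteMeasure μ] :
    ∃ D : ℝ, 0 ≤ D ∧ ∀ (K : E → E → ℂ) (T : Lp ℂ 2 μ →L[ℂ] Lp ℂ 2 μ) (M : ℝ), 0 ≤ M →
      (∀ᵐ x ∂μ, ∀ᵐ y ∂μ, ‖K x y‖ ≤ M) → IsIntegralOperator K T → ‖T‖ ≤ D * M := by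
  refine ⟨(measureUnivNNReal μ : ℝ) ^ (2 : ENNReal).toReal⁻¹ *
    (μ Set.univ ^ (1 / 2 : ℝ)).toReal, by positivity, fun K T M hM0 hM hT => ?_⟩
  refine ContinuousLinearMap.opNorm_le_bound _ (by positivity) fun f => ?_
  have h : ∀ᵐ x ∂μ, ‖T f x‖ ≤ M * ∫ y, ‖f y‖ ∂μ := by
    filter_upwards [hT f, hM] with x hx hMx
    rw [hx]
    exact norm_integral_kernel_mul_le f hMx
  refine (Lp.norm_le_of_ae_bound (by positivity) h).trans ?_
  calc _ ≤ (measureUnivNNReal μ : ℝ) ^ (2 : ENNReal).toReal⁻¹ *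
        (M * ((μ Set.univ ^ (1 / 2 : ℝ)).toReal * ‖f‖)) := by
        gcongr; exact integral_norm_le_mul_norm f
    _ = _ := by ring

lemma integrable_kernel_mul (hKm : Measurable (Function.uncurry K)) {M : ℝ}
    (hM : ∀ x y, ‖K x y‖ ≤ M) (f : Lp ℂ 2 μ) (x : E) : Integrable (fun y => K x y * f y) μ :=
  (integrable_of_Lp_two f).bdd_mul (c := M)
    (hKm.comp measurable_prodMk_left).aestronglyMeasurable (ae_of_all _ fun y => hM x y)

lemma exists_isIntegralOperator (hKm : Measurable (Function.uncurry K)) {M : ℝ}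
    (hM : ∀ x y, ‖K x y‖ ≤ M) : ∃ T : Lp ℂ 2 μ →L[ℂ] Lp ℂ 2 μ, IsIntegralOperator K T := by
  have hmem : ∀ f : Lp ℂ 2 μ, MemLp (fun x => ∫ y, K x y * f y ∂μ) 2 μ := by
    intro f
    refine MemLp.of_bound ?_ (M * ∫ y, ‖f y‖ ∂μ)
      (ae_of_all _ fun x => norm_integral_kernel_mul_le f (ae_of_all _ (hM x)))
    exact (StronglyMeasurable.integral_prod_right' (ν := μ)
      (f := fun p : E × E => K p.1 p.2 * f p.2) (hKm.stronglyMeasurable.mul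
        ((Lp.stronglyMeasurable f).comp_measurable measurable_snd))).aestronglyMeasurable
  let T : Lp ℂ 2 μ →ₗ[ℂ] Lp ℂ 2 μ :=
    { toFun := fun f => (hmem f).toLp _
      map_add' := fun f g => by
        refine Lp.ext ?_
        filter_upwards [(hmem (f + g)).coeFn_toLp, (hmem f).coeFn_toLp, (hmem g).coeFn_toLp,
          Lp.coeFn_add ((hmem f).toLp _) ((hmem g).toLp _)] with x h1 h2 h3 h4
        rw [h1, h4, Pi.add_apply, h2, h3, ← integral_add (integrable_kernel_mul hKm hM f x)
          (integrable_kernel_mul hKm hM g x)]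
        refine integral_congr_ae ?_
        filter_upwards [Lp.coeFn_add f g] with y hy
        rw [hy, Pi.add_apply, mul_add]
      map_smul' := fun c f => by
        refine Lp.ext ?_
        filter_upwards [(hmem (c • f)).coeFn_toLp, (hmem f).coeFn_toLp,
          Lp.coeFn_smul c ((hmem f).toLp _)] with x h1 h2 h4
        rw [h1, RingHom.id_apply, h4, Pi.smul_apply, h2, smul_eq_mul, ← integral_const_mul]
        refine integral_congr_ae ?_
        filter_upwards [Lp.coeFn_smul c f] with y hy
        rw [hy, Pi.smul_apply, smul_eq_mul]
        ring }
  -- A point of `E` is needed to deduce `0 ≤ M` from the bound on `K`.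
  rcases isEmpty_or_nonempty E with hE | ⟨⟨x₀⟩⟩
  · exact ⟨0, fun f => ae_of_all _ fun x => isEmptyElim x⟩
  have hM0 : 0 ≤ M := (norm_nonneg _).trans (hM x₀ x₀)
  refine ⟨T.mkContinuous ((measureUnivNNReal μ : ℝ) ^ (2 : ENNReal).toReal⁻¹ *
    (M * (μ Set.univ ^ (1 / 2 : ℝ)).toReal)) fun f => ?_, fun f => (hmem f).coeFn_toLp⟩
  have h : ∀ᵐ x ∂μ, ‖T f x‖ ≤ M * ∫ y, ‖f y‖ ∂μ := by
    filter_upwards [(hmem f).coeFn_toLp] with x hx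
    refine (congrArg norm hx).trans_le ?_
    exact norm_integral_kernel_mul_le f (ae_of_all _ (hM x))
  refine (Lp.norm_le_of_ae_bound (by positivity) h).trans ?_
  calc _ ≤ (measureUnivNNReal μ : ℝ) ^ (2 : ENNReal).toReal⁻¹ *
        (M * ((μ Set.univ ^ (1 / 2 : ℝ)).toReal * ‖f‖)) := by
        gcongr; exact integral_norm_le_mul_norm f
    _ = _ := by ring

lemma IsIntegralOperator.sub {K' : E → E → ℂ} {T T' : Lp ℂ 2 μ →L[ℂ] Lp ℂ 2 μ}
    (hT : IsIntegralOperator K T) (hT' : IsIntegralOperator K' T')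
    (hKm : Measurable (Function.uncurry K)) {M : ℝ} (hM : ∀ x y, ‖K x y‖ ≤ M)
    (hKm' : Measurable (Function.uncurry K')) (hM' : ∀ x y, ‖K' x y‖ ≤ M) :
    IsIntegralOperator (fun x y => K x y - K' x y) (T - T') := by
  intro f
  filter_upwards [hT f, hT' f, Lp.coeFn_sub (T f) (T' f)] with x h1 h2 h3
  rw [sub_apply, h3, Pi.sub_apply, h1, h2,
    ← integral_sub (integrable_kernel_mul hKm hM f x) (integrable_kernel_mul hKm' hM' f x)]
  simp only [sub_mul]

/-- An integral operator whose kernel is constant on finitely many product cells has finite rank. -/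
lemma IsIntegralOperator.isCompactOperator_of_simpleFunc (π : SimpleFunc E E)
    {T : Lp ℂ 2 μ →L[ℂ] Lp ℂ 2 μ} (hT : IsIntegralOperator (fun x y => K (π x) (π y)) T) :
    IsCompactOperator T := by
  let e : E → Lp ℂ 2 μ := fun a =>
    indicatorConstLp 2 (π.measurableSet_preimage {a}) (measure_ne_top μ _) (1 : ℂ)
  let W : Submodule ℂ (Lp ℂ 2 μ) := Submodule.span ℂ (e '' (π.range : Set E))
  have : FiniteDimensional ℂ W :=
    FiniteDimensional.span_of_finite ℂ ((Finset.finite_toSet _).image e)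
  refine isCompactOperator_of_forall_mem T W fun f => ?_
  have : T f = ∑ a ∈ π.range, (∫ y, K a (π y) * f y ∂μ) • e a := by
    refine Lp.ext ?_
    have h1 : ∀ a ∈ π.range, (((∫ y, K a (π y) * f y ∂μ) • e a : Lp ℂ 2 μ) : E → ℂ) =ᵐ[μ]
        fun x => (∫ y, K a (π y) * f y ∂μ) * (π ⁻¹' {a}).indicator (fun _ => 1) x := by
      intro a _
      filter_upwards [Lp.coeFn_smul (∫ y, K a (π y) * f y ∂μ) (e a),
        indicatorConstLp_coeFn (p := 2) (hs := π.measurableSet_preimage {a})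
          (hμs := measure_ne_top μ _) (c := (1 : ℂ))] with x h2 h3
      rw [h2, Pi.smul_apply, h3, smul_eq_mul]
    have h2 : ∀ᵐ x ∂μ, ∀ a ∈ π.range, (((∫ y, K a (π y) * f y ∂μ) • e a : Lp ℂ 2 μ) : E → ℂ) x =
        (∫ y, K a (π y) * f y ∂μ) * (π ⁻¹' {a}).indicator (fun _ => 1) x :=
      (Finset.eventually_all _).2 h1
    filter_upwards [hT f, h2, Lp.coeFn_finsetSum π.range
      fun a => (∫ y, K a (π y) * f y ∂μ) • e a] with x h3 h4 h5
    rw [h3, h5, Finset.sum_apply, Finset.sum_congr rfl h4, Finset.sum_eq_single (π x)]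
    · simp
    · intro b _ hb
      simp [Set.indicator, hb.symm]
    · intro h
      exact absurd (π.mem_range_self x) h
  rw [this]
  exact Submodule.sum_mem _ fun a ha =>
    W.smul_mem _ (Submodule.subset_span ⟨a, ha, rfl⟩)

end IntegralOperator

/-! ### Compactness and positivity of the operator of a continuous kernel. -/

section ContinuousKernel

open Filter Topology ComplexConjugate

/-- A compact set is mapped into itself by simple functions uniformly close to the identity. -/
lemma exists_simpleFunc_dist_lt {E : Type*} [PseudoMetricSpace E] [MeasurableSpace E]
    [OpensMeasurableSpace E] [SecondCountableTopology E] {S : Set E} (hS : IsCompact S)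
    (hne : S.Nonempty) {δ : ℝ} (hδ : 0 < δ) :
    ∃ π : SimpleFunc E E, (∀ x, π x ∈ S) ∧ ∀ x ∈ S, dist (π x) x < δ := by
  have : Nonempty S := hne.to_subtype
  obtain ⟨u, hu⟩ := TopologicalSpace.exists_dense_seq S
  obtain ⟨t, ht⟩ := hS.elim_finite_subcover (fun n => Metric.ball (u n : E) δ)
    (fun _ => Metric.isOpen_ball) fun x hx => by
      obtain ⟨_, hn, n, rfl⟩ := Metric.dense_iff.1 hu ⟨x, hx⟩ δ hδ
      refine Set.mem_iUnion.2 ⟨n, ?_⟩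
      rw [Metric.mem_ball, dist_comm]
      exact hn
  -- The bound `t.sup id` is the largest index in the subcover. The point nearest to `x` among all
  -- `u k` up to it is at least as close as the centre of the ball containing `x`.
  refine ⟨SimpleFunc.nearestPt (fun n => (u n : E)) (t.sup id), fun x => ?_, fun x hx => ?_⟩
  · exact (u _).2
  · obtain ⟨k, hk, hxk⟩ := Set.mem_iUnion₂.1 (ht hx)
    have := SimpleFunc.edist_nearestPt_le (fun n => (u n : E)) x
      (Finset.le_sup (f := id) hk : k ≤ t.sup id)
    rw [edist_dist, edist_dist, ENNReal.ofReal_le_ofReal_iff dist_nonneg] at this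
    rw [Metric.mem_ball, dist_comm] at hxk
    exact this.trans_lt hxk

lemma IsIntegralOperator.inner_apply_self {E : Type*} [MeasurableSpace E] {μ : Measure E}
    {K : E → E → ℂ} [IsFiniteMeasure μ]
    {T : Lp ℂ 2 μ →L[ℂ] Lp ℂ 2 μ} (hT : IsIntegralOperator K T) (f : Lp ℂ 2 μ) :
    inner ℂ f (T f) = ∫ x, ∫ y, conj (f x) * K x y * f y ∂μ ∂μ := by
  rw [L2.inner_def]
  refine integral_congr_ae ?_
  filter_upwards [hT f] with x hx
  rw [hx, RCLike.inner_apply', ← integral_const_mul]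
  simp only [mul_assoc]

variable {E : Type*} [PseudoMetricSpace E] [MeasurableSpace E] [OpensMeasurableSpace E]
    [SecondCountableTopology E] {μ : Measure E} {K : E → E → ℂ} {S : Set E}

/-- By uniform continuity on `S ×ˢ S`, the kernel is uniformly approximated there by kernels
constant on finitely many cells. Their operators have finite rank, and compact operators are closed
in norm. -/
lemma IsIntegralOperator.isCompactOperator [IsFiniteMeasure (μ.restrict S)] (hS : IsCompact S)
    (hSm : MeasurableSet S) (hne : S.Nonempty) (hKc : Continuous (Function.uncurry K)) {M : ℝ}
    (hM : ∀ x y, ‖K x y‖ ≤ M)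
    {T : Lp ℂ 2 (μ.restrict S) →L[ℂ] Lp ℂ 2 (μ.restrict S)} (hT : IsIntegralOperator K T) :
    IsCompactOperator T := by
  obtain ⟨D, hD0, hD⟩ := exists_norm_le_of_isIntegralOperator (μ.restrict S)
  refine isClosed_setOfPred_isCompactOperator.closure_subset
    (Metric.mem_closure_iff.2 fun ε hε => ?_)
  -- Dividing by `D + 1` covers `D = 0` and gives the strict bound `D * (ε / (D + 1)) < ε`.
  have hη : 0 < ε / (D + 1) := by positivity
  obtain ⟨δ, hδ, hK⟩ := Metric.uniformContinuousOn_iff.1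
    ((hS.prod hS).uniformContinuousOn_of_continuous hKc.continuousOn) _ hη
  obtain ⟨π, hπS, hπ⟩ := exists_simpleFunc_dist_lt hS hne hδ
  have hm : Measurable (Function.uncurry fun x y => K (π x) (π y)) :=
    hKc.measurable.comp ((π.measurable.comp measurable_fst).prodMk
      (π.measurable.comp measurable_snd))
  obtain ⟨T', hT'⟩ := exists_isIntegralOperator (μ := μ.restrict S) hm
    fun x y => hM (π x) (π y)
  refine ⟨T', hT'.isCompactOperator_of_simpleFunc π, ?_⟩
  rw [dist_eq_norm]
  have hsub := hT.sub hT' hKc.measurable hM hm fun x y => hM (π x) (π y)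
  have hle := hD _ _ _ hη.le (by
    filter_upwards [ae_restrict_mem hSm] with x hx
    filter_upwards [ae_restrict_mem hSm] with y hy
    have := hK (x, y) ⟨hx, hy⟩ (π x, π y) ⟨hπS x, hπS y⟩ (by
      rw [Prod.dist_eq, dist_comm x, dist_comm y]
      exact max_lt (hπ x hx) (hπ y hy))
    rw [dist_eq_norm] at this
    exact this.le) hsub
  refine hle.trans_lt ?_
  rw [mul_div_assoc', div_lt_iff₀ (by positivity)]
  nlinarith

lemma IsIntegralOperator.isPositive [IsFiniteMeasure μ] (hK : IsCovarianceFunction K)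
    (hKc : Continuous (Function.uncurry K)) {M : ℝ} (hM : ∀ x y, ‖K x y‖ ≤ M)
    {T : Lp ℂ 2 μ →L[ℂ] Lp ℂ 2 μ} (hT : IsIntegralOperator K T) : T.IsPositive := by
  rw [ContinuousLinearMap.isPositive_iff_complex]
  intro f
  have h := hK.integral_nonneg hKc hM (integrable_of_Lp_two f)
  rw [← hT.inner_apply_self, Complex.le_def] at h
  have h2 : inner ℂ (T f) f = inner ℂ f (T f) := by
    rw [← inner_conj_symm]
    exact Complex.conj_eq_iff_im.2 h.2.symm
  rw [h2]
  exact ⟨Complex.ext rfl h.2, h.1⟩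

end ContinuousKernel

/-! ### The eigenvalue condition as an upper bound for the quadratic form. -/

section QuadraticForm

open Filter Topology ComplexConjugate

variable {d : ℕ} {C : EuclideanSpace ℝ (Fin d) → EuclideanSpace ℝ (Fin d) → ℂ}

/-- On a compact set the quadratic form of the kernel is dominated by the squared `L²` norm. -/
lemma norm_setIntegral_kernel_le (hC1 : CondC1 C) (hC2 : CondC2 C) {M : ℝ}
    (hM : ∀ x y, ‖C x y‖ ≤ M) {S : Set (EuclideanSpace ℝ (Fin d))} (hS : IsCompact S)
    (hne : S.Nonempty) {f : EuclideanSpace ℝ (Fin d) → ℂ} (hf : MemLp f 2 (volume.restrict S)) :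
    ‖∫ x in S, ∫ y in S, conj (f x) * C x y * f y‖ ≤ ∫ x in S, ‖f x‖ ^ 2 := by
  have : IsFiniteMeasure (volume.restrict S) := ⟨by simpa using hS.measure_lt_top⟩
  obtain ⟨T, hT⟩ := exists_isIntegralOperator (μ := volume.restrict S) hC1.1.measurable hM
  have hcomp := hT.isCompactOperator hS hS.measurableSet hne hC1.1 hM
  have hnorm : ‖T‖ ≤ 1 := by
    -- An abstract eigenvector in `L²(S)` is a nonzero eigenfunction of the kernel, so (C2) bounds
    -- its eigenvalue.
    refine norm_le_one_of_eigenvalue_le_one hcomp (hT.isPositive hC1.2 hC1.1 hM) fun c hc => ?_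
    obtain ⟨v, hv⟩ := hc.exists_hasEigenvector
    refine hC2 S hS c ⟨v, Lp.memLp v, fun h0 => hv.2 ?_, ?_⟩
    · exact (Lp.eq_zero_iff_ae_eq_zero).2 h0
    · have hTv : T v = (c : ℂ) • v := hv.apply_eq_smul
      filter_upwards [hT v, Lp.coeFn_smul (c : ℂ) v] with x h1 h2
      rw [← h1, hTv, h2, Pi.smul_apply, smul_eq_mul]
  have hQ : ∫ x in S, ∫ y in S, conj (f x) * C x y * f y =
      inner ℂ (hf.toLp f) (T (hf.toLp f)) := by
    rw [hT.inner_apply_self]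
    refine integral_congr_ae ?_
    filter_upwards [hf.coeFn_toLp] with x hx
    refine integral_congr_ae ?_
    filter_upwards [hf.coeFn_toLp] with y hy
    rw [hx, hy]
  rw [hQ, integral_norm_sq_eq_norm_toLp_sq hf]
  calc _ ≤ ‖hf.toLp f‖ * ‖T (hf.toLp f)‖ := norm_inner_le_norm _ _
    _ ≤ ‖hf.toLp f‖ * (1 * ‖hf.toLp f‖) := by
      gcongr
      exact T.le_of_opNorm_le hnorm _
    _ = _ := by ring

/-- The bound on each closed ball is uniform, so it survives exhaustion of the space by balls;
integrability of the full integrand on the product gives the limit. -/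
lemma norm_integral_kernel_le (hC1 : CondC1 C) (hC2 : CondC2 C) {M : ℝ}
    (hM : ∀ x y, ‖C x y‖ ≤ M) {f : EuclideanSpace ℝ (Fin d) → ℂ} (hf : Integrable f)
    (hf2 : MemLp f 2) : ‖∫ x, ∫ y, conj (f x) * C x y * f y‖ ≤ ∫ x, ‖f x‖ ^ 2 := by
  have hint := integrable_conj_mul_kernel_mul hf hC1.1.measurable hM
  let S : ℕ → Set (EuclideanSpace ℝ (Fin d)) := fun n => Metric.closedBall 0 n
  have hSm : ∀ n, MeasurableSet (S n ×ˢ S n) := fun n =>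
    Metric.isClosed_closedBall.measurableSet.prod Metric.isClosed_closedBall.measurableSet
  have hmono : Monotone fun n => S n ×ˢ S n := fun m n hmn =>
    Set.prod_mono (Metric.closedBall_subset_closedBall (by exact_mod_cast hmn))
      (Metric.closedBall_subset_closedBall (by exact_mod_cast hmn))
  have hU : ⋃ n, S n ×ˢ S n = Set.univ := by
    refine Set.eq_univ_of_forall fun p => ?_
    obtain ⟨n, hn⟩ := exists_nat_ge (max ‖p.1‖ ‖p.2‖)
    refine Set.mem_iUnion.2 ⟨n, ?_, ?_⟩
    · simpa [S] using (le_max_left _ _).trans hn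
    · simpa [S] using (le_max_right _ _).trans hn
  have hlim := tendsto_setIntegral_of_monotone hSm hmono hint.integrableOn
  rw [hU, Measure.restrict_univ, integral_prod _ hint] at hlim
  refine le_of_tendsto' hlim.norm fun n => ?_
  have hprod : ∫ p in S n ×ˢ S n, conj (f p.1) * C p.1 p.2 * f p.2 ∂(volume.prod volume) =
      ∫ x in S n, ∫ y in S n, conj (f x) * C x y * f y := by
    rw [← Measure.prod_restrict]
    exact integral_prod _ (by rw [Measure.prod_restrict]; exact hint.integrableOn)
  refine (congrArg norm hprod).trans_le ?_
  refine (norm_setIntegral_kernel_le hC1 hC2 hM (isCompact_closedBall 0 (n : ℝ))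
    (Metric.nonempty_closedBall.2 (Nat.cast_nonneg n)) (hf2.restrict _)).trans ?_
  exact setIntegral_le_integral ((memLp_two_iff_integrable_sq_norm hf.aestronglyMeasurable).1 hf2)
    (ae_of_all _ fun x => by positivity)

end QuadraticForm

/-! ### Almost everywhere nonnegativity tested on squares of smooth bumps. -/

section NonnegTesting

open Filter Topology

variable {V : Type*} [NormedAddCommGroup V] [NormedSpace ℝ V] [FiniteDimensional ℝ V]
  [MeasurableSpace V] [BorelSpace V] {μ : Measure V}

/-- A locally integrable function with nonnegative integral over all compact sets is nonnegative
almost everywhere. -/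
lemma ae_nonneg_of_forall_setIntegral_isCompact_nonneg [IsLocallyFiniteMeasure μ] {f : V → ℝ}
    (hf : LocallyIntegrable f μ)
    (h : ∀ s, IsCompact s → 0 ≤ ∫ x in s, f x ∂μ) : ∀ᵐ x ∂μ, 0 ≤ f x := by
  have hfm := hf.aestronglyMeasurable
  set g := hfm.mk f with hg
  have hgf : f =ᵐ[μ] g := hfm.ae_eq_mk
  have hA : MeasurableSet {x | g x < 0} :=
    measurableSet_lt hfm.stronglyMeasurable_mk.measurable measurable_const
  have h0 : μ {x | g x < 0} = 0 := by
    by_contra hne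
    -- Inner regularity: were the negativity set of positive measure, it would contain a compact set
    -- of positive measure, over which the integral is negative.
    obtain ⟨s, hsA, hs, hpos⟩ := hA.exists_lt_isCompact (pos_iff_ne_zero.2 hne)
    have h1 : 0 ≤ ∫ x in s, g x ∂μ := (h s hs).trans_eq
      (integral_congr_ae (ae_restrict_of_ae hgf))
    have hint : IntegrableOn (fun x => -g x) s μ :=
      ((hf.integrableOn_isCompact hs).congr (ae_restrict_of_ae hgf)).neg
    have h2 : 0 < ∫ x in s, -g x ∂μ := by
      rw [setIntegral_pos_iff_support_of_nonneg_ae _ hint]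
      · refine hpos.trans_le (measure_mono fun x hx => ⟨?_, hx⟩)
        exact (neg_pos.2 (hsA hx)).ne'
      · filter_upwards [ae_restrict_mem hs.measurableSet] with x hx
        exact (neg_pos.2 (hsA hx)).le
    rw [integral_neg] at h2
    linarith
  have h3 : ∀ᵐ x ∂μ, ¬ g x < 0 := by
    rw [ae_iff]
    simpa using h0
  filter_upwards [hgf, h3] with x hx hx'
  rw [hx]
  exact not_lt.1 hx'

open scoped ContDiff in
/-- The integral of `f` over a compact set is a limit of integrals of `f` against squares of test
functions. -/
lemma exists_seq_tendsto_setIntegral {s : Set V} (hs : IsCompact s) {f : V → ℂ}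
    (hf : LocallyIntegrable f μ) :
    ∃ g : ℕ → V → ℝ, (∀ n, ContDiff ℝ ∞ (g n) ∧ HasCompactSupport (g n)) ∧
      Tendsto (fun n => ∫ x, ((g n x) ^ 2 : ℝ) * f x ∂μ) atTop (𝓝 (∫ x in s, f x ∂μ)) := by
  obtain ⟨δ, δpos, hδ⟩ : ∃ δ, 0 < δ ∧ IsCompact (Metric.cthickening δ s) :=
    hs.exists_isCompact_cthickening
  obtain ⟨u, -, u_pos, u_lim⟩ : ∃ u, StrictAnti u ∧ (∀ n : ℕ, u n ∈ Set.Ioo 0 δ)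
    ∧ Tendsto u atTop (𝓝 0) := exists_seq_strictAnti_tendsto' δpos
  have hvK : ∀ n, Metric.thickening (u n) s ⊆ Metric.cthickening δ s := fun n =>
    Metric.thickening_subset_cthickening_of_le (u_pos n).2.le _
  have : ∀ n, ∃ g : V → ℝ, Function.support g = Metric.thickening (u n) s ∧ ContDiff ℝ ∞ g ∧
      Set.range g ⊆ Set.Icc 0 1 ∧ ∀ x ∈ s, g x = 1 := by
    intro n
    rcases exists_contMDiff_support_eq_eq_one_iff (modelWithCornersSelf ℝ V)
      Metric.isOpen_thickening hs.isClosed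
      (Metric.self_subset_thickening (u_pos n).1 s) with ⟨g, g_smooth, g_range, g_supp, hg⟩
    exact ⟨g, g_supp, g_smooth.contDiff, g_range, fun x hx => (hg x).1 hx⟩
  choose g g_supp g_diff g_range hg using this
  refine ⟨g, fun n => ⟨g_diff n, HasCompactSupport.of_support_subset_isCompact hδ
    ((g_supp n).trans_subset (hvK n))⟩, ?_⟩
  -- The bumps equal `1` on `s` and are supported in shrinking thickenings, so their squares tend
  -- pointwise to the indicator of `s`. All are dominated by `|f|` on one compact thickening.
  rw [← integral_indicator hs.measurableSet]
  refine tendsto_integral_of_dominated_convergence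
    ((Metric.cthickening δ s).indicator fun x => ‖f x‖) (fun n => ?_) ?_
    (fun n => ae_of_all _ fun x => ?_) (ae_of_all _ fun x => ?_)
  · exact (Complex.continuous_ofReal.comp
      ((g_diff n).continuous.pow 2)).aestronglyMeasurable.mul hf.aestronglyMeasurable
  · rw [integrable_indicator_iff hδ.measurableSet]
    exact (hf.integrableOn_isCompact hδ).norm
  · by_cases hx : x ∈ Metric.cthickening δ s
    · rw [Set.indicator_of_mem hx, norm_mul, Complex.norm_real,
        Real.norm_of_nonneg (sq_nonneg _)]
      have := g_range n ⟨x, rfl⟩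
      exact mul_le_of_le_one_left (norm_nonneg _) (pow_le_one₀ this.1 this.2)
    · have : g n x = 0 := by
        by_contra h0
        exact hx (hvK n ((g_supp n).subset h0))
      rw [Set.indicator_of_notMem hx, this]
      simp
  · by_cases hx : x ∈ s
    · rw [Set.indicator_of_mem hx]
      simp [hg _ x hx]
    · rw [Set.indicator_of_notMem hx]
      refine tendsto_const_nhds.congr' ?_
      -- The empty set is separated because `Metric.infDist` to it is zero by convention.
      have hpos : 0 < Metric.infDist x s ∨ s = ∅ := by
        rcases s.eq_empty_or_nonempty with h0 | h0
        · exact Or.inr h0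
        · exact Or.inl ((hs.isClosed.notMem_iff_infDist_pos h0).1 hx)
      have hout : ∀ᶠ n in atTop, x ∉ Metric.thickening (u n) s := by
        rcases hpos with h0 | h0
        · filter_upwards [(tendsto_order.1 u_lim).2 _ h0] with n hn hxn
          have hne : s.Nonempty := by
            by_contra hne
            simp [Set.not_nonempty_iff_eq_empty.1 hne] at h0
          rw [Metric.mem_thickening_iff_infDist_lt hne] at hxn
          exact lt_asymm hn hxn
        · simp [h0]
      filter_upwards [hout] with n hn
      have : g n x = 0 := by
        by_contra h0
        exact hn ((g_supp n).subset h0)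
      simp [this]

open scoped ContDiff in
/-- A locally integrable function whose integrals against squares of test functions are nonnegative
is nonnegative almost everywhere. -/
lemma ae_nonneg_of_forall_integral_sq_mul_nonneg [IsLocallyFiniteMeasure μ] {f : V → ℂ}
    (hf : LocallyIntegrable f μ)
    (h : ∀ g : V → ℝ, ContDiff ℝ ∞ g → HasCompactSupport g →
      0 ≤ ∫ x, ((g x) ^ 2 : ℝ) * f x ∂μ) : ∀ᵐ x ∂μ, 0 ≤ f x := by
  have hs : ∀ s, IsCompact s → 0 ≤ ∫ x in s, f x ∂μ := by
    intro s hs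
    obtain ⟨g, hg, hlim⟩ := exists_seq_tendsto_setIntegral hs hf
    exact ge_of_tendsto' hlim fun n => h (g n) (hg n).1 (hg n).2
  have hint : ∀ s, IsCompact s → Integrable f (μ.restrict s) := fun s hs =>
    hf.integrableOn_isCompact hs
  have hre : LocallyIntegrable (fun x => (f x).re) μ :=
    locallyIntegrable_iff.2 fun s hs => (hint s hs).re
  have him : LocallyIntegrable (fun x => (f x).im) μ :=
    locallyIntegrable_iff.2 fun s hs => (hint s hs).im
  have himz : ∀ s, IsCompact s → ∫ x in s, (f x).im ∂μ = 0 := fun s hsc =>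
    (integral_im (hint s hsc)).trans (Complex.le_def.1 (hs s hsc)).2.symm
  have h1 := ae_nonneg_of_forall_setIntegral_isCompact_nonneg hre fun s hsc =>
    (Complex.le_def.1 (hs s hsc)).1.trans_eq (integral_re (hint s hsc)).symm
  have h2 := ae_nonneg_of_forall_setIntegral_isCompact_nonneg him fun s hsc => (himz s hsc).ge
  have h3 := ae_nonneg_of_forall_setIntegral_isCompact_nonneg him.neg fun s hsc => by
    simp only [Pi.neg_apply, integral_neg, himz s hsc, neg_zero, le_refl]
  filter_upwards [h1, h2, h3] with x h1 h2 h3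
  exact Complex.le_def.2 ⟨h1, le_antisymm h2 (neg_nonneg.1 h3)⟩

end NonnegTesting

/-! ### The Fourier transform of `C₀` as a density, and its integrability. -/

section SpectralDensity

open Filter Topology ComplexConjugate

variable {V : Type*} [NormedAddCommGroup V] [InnerProductSpace ℝ V] [FiniteDimensional ℝ V]
  [MeasurableSpace V] [BorelSpace V]

lemma fourierInv_fourierChar_smul (g : V → ℂ) (u x : V) :
    𝓕⁻ (fun v => Real.fourierChar (-inner ℝ v u) • g v) x = 𝓕⁻ g (x - u) := by
  simp only [Real.fourierInv_eq]
  refine integral_congr_ae (ae_of_all _ fun v => ?_)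
  simp only [smul_smul, ← AddChar.map_add_eq_mul, ← sub_eq_add_neg, inner_sub_right]

/-- The Fourier transform of `|g|²` is the autocorrelation of the inverse transform of `g`. -/
lemma fourier_conj_mul_self (g : SchwartzMap V ℂ) (u : V) :
    𝓕 (fun v => conj (g v) * g v) u =
      ∫ x, conj ((𝓕⁻ g : SchwartzMap V ℂ) x) * (𝓕⁻ g : SchwartzMap V ℂ) (x - u) := by
  have hg : 𝓕 ((𝓕⁻ g : SchwartzMap V ℂ) : V → ℂ) = g := by
    rw [← SchwartzMap.fourier_coe, FourierTransform.fourier_fourierInv_eq]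
  have hint : Integrable (fun v => Real.fourierChar (-inner ℝ v u) • g v) := by
    have := (Real.fourierIntegral_convergent_iff (f := (g : V → ℂ)) (μ := volume) u).2 g.integrable
    exact this
  -- One factor of `|g|²` is written as the transform of `𝓕⁻ g`; the other carries the character,
  -- which the inverse transform turns into a translation by `u`.
  have h := integral_conj_fourier_mul_eq (𝓕⁻ g : SchwartzMap V ℂ).integrable hint
  simp only [hg, fourierInv_fourierChar_smul] at h
  rw [Real.fourier_eq, SchwartzMap.fourierInv_coe] at *
  rw [← h]
  refine integral_congr_ae (ae_of_all _ fun v => ?_)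
  simp only [Circle.smul_def, smul_eq_mul]
  ring

/-- The transform of `|g|²` is an autocorrelation; Fubini and the substitution `u = x - y` turn its
pairing with `C₀` into the stationary quadratic form. -/
lemma integral_fourier_conj_mul_self_mul {C₀ : V → ℂ} (hC₀ : Continuous C₀) {M : ℝ}
    (hM : ∀ x, ‖C₀ x‖ ≤ M) (g : SchwartzMap V ℂ) :
    ∫ u, 𝓕 (fun v => conj (g v) * g v) u * C₀ u =
      ∫ x, ∫ y, conj ((𝓕⁻ g : SchwartzMap V ℂ) x) * C₀ (x - y) *
        (𝓕⁻ g : SchwartzMap V ℂ) y := by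
  set f : SchwartzMap V ℂ := 𝓕⁻ g with hf
  have hfc : Integrable (fun x => conj (f x)) :=
    (LinearIsometryEquiv.integrable_comp_iff Complex.conjLIE).2 f.integrable
  have hint : Integrable (fun p : V × V => C₀ p.1 * (conj (f p.2) * f (p.2 - p.1)))
      (volume.prod volume) := by
    have h := hfc.convolution_integrand (ContinuousLinearMap.mul ℂ ℂ)
      (f.integrable (μ := volume)).comp_neg
    refine (h.bdd_mul (c := M) (f := fun p : V × V => C₀ p.1)
      (hC₀.comp continuous_fst).aestronglyMeasurable (ae_of_all _ fun p => hM p.1)).congr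
      (ae_of_all _ fun p => ?_)
    simp
  calc ∫ u, 𝓕 (fun v => conj (g v) * g v) u * C₀ u
      = ∫ u, ∫ x, C₀ u * (conj (f x) * f (x - u)) := by
        refine integral_congr_ae (ae_of_all _ fun u => ?_)
        simp only [fourier_conj_mul_self, integral_const_mul]
        rw [mul_comm]
    _ = ∫ x, ∫ u, C₀ u * (conj (f x) * f (x - u)) := integral_integral_swap hint
    _ = _ := by
        refine integral_congr_ae (ae_of_all _ fun x => ?_)
        simp only
        rw [← integral_sub_left_eq_self (fun u => C₀ u * (conj (f x) * f (x - u))) volume x]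
        refine integral_congr_ae (ae_of_all _ fun y => ?_)
        simp only [sub_sub_cancel]
        ring

open scoped ContDiff in
/-- Integrating the Fourier transform of `C₀` against the square of a test function gives the
quadratic form of the stationary kernel. -/
lemma exists_integral_sq_mul_fourier_eq {C₀ : V → ℂ} (hC₀ : Continuous C₀) {M : ℝ}
    (hM : ∀ x, ‖C₀ x‖ ≤ M) (hL : MemLp C₀ 2) {g : V → ℝ} (hg : ContDiff ℝ ∞ g)
    (hgc : HasCompactSupport g) :
    ∃ f : SchwartzMap V ℂ, ∫ x, ‖f x‖ ^ 2 = ∫ x, (g x) ^ 2 ∧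
      ∫ x, ((g x) ^ 2 : ℝ) * (𝓕 (hL.toLp C₀) : Lp ℂ 2 (volume : Measure V)) x =
        ∫ x, ∫ y, conj (f x) * C₀ (x - y) * f y := by
  have hgc' : HasCompactSupport (fun x => (g x : ℂ)) := hgc.comp_left (g := Complex.ofReal) rfl
  have hg' : ContDiff ℝ ∞ (fun x => (g x : ℂ)) := Complex.ofRealCLM.contDiff.comp hg
  have hqc : HasCompactSupport (fun x => (((g x) ^ 2 : ℝ) : ℂ)) :=
    hgc.comp_left (g := fun t : ℝ => ((t ^ 2 : ℝ) : ℂ)) (by simp)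
  have hq : ContDiff ℝ ∞ (fun x => (((g x) ^ 2 : ℝ) : ℂ)) :=
    Complex.ofRealCLM.contDiff.comp (hg.pow 2)
  let G := hgc'.toSchwartzMap hg'
  -- The witness is the inverse transform of the test function; Plancherel gives its norm.
  refine ⟨𝓕⁻ G, ?_, ?_⟩
  · have h := SchwartzMap.integral_norm_sq_fourier (𝓕⁻ G)
    rw [FourierTransform.fourier_fourierInv_eq] at h
    rw [← h]
    refine integral_congr_ae (ae_of_all _ fun x => ?_)
    change ‖(g x : ℂ)‖ ^ 2 = g x ^ 2
    rw [Complex.norm_real, Real.norm_eq_abs, sq_abs]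
  · rw [← integral_fourier_conj_mul_self_mul hC₀ hM G]
    have h := integral_mul_fourier_Lp_eq (hL.toLp C₀) (hqc.toSchwartzMap hq)
    refine h.trans (integral_congr_ae ?_)
    filter_upwards [hL.coeFn_toLp] with x hx
    rw [hx]
    congr 1
    refine congrFun (congrArg _ (funext fun v => ?_)) x
    change (((g v) ^ 2 : ℝ) : ℂ) = conj (g v : ℂ) * (g v : ℂ)
    rw [Complex.conj_ofReal]
    push_cast
    ring

lemma integrable_rexp_neg_mul_sq_norm {b : ℝ} (hb : 0 < b) :
    Integrable (fun v : V => Real.exp (-b * ‖v‖ ^ 2)) := by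
  have h := GaussianFourier.integrable_cexp_neg_mul_sq_norm_add (V := V) (b := (b : ℂ))
    (by simpa using hb) 0 0
  refine h.norm.congr (ae_of_all _ fun v => ?_)
  simp only [Complex.norm_exp]
  rw [zero_mul, add_zero, ← Complex.ofReal_neg, ← Complex.ofReal_pow, ← Complex.ofReal_mul,
    Complex.ofReal_re]

/-- Gaussian means of a nonnegative spectral density are bounded by the supremum of `C₀`. -/
lemma integral_gaussian_mul_le {C₀ : V → ℂ} {M : ℝ} (hM : ∀ x, ‖C₀ x‖ ≤ M)
    (hL : MemLp C₀ 2) {φ : V → ℝ} (hφ0 : ∀ x, 0 ≤ φ x)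
    (hφ : (𝓕 (hL.toLp C₀) : Lp ℂ 2 (volume : Measure V)) =ᵐ[volume] fun x => (φ x : ℂ))
    {b : ℝ} (hb : 0 < b) :
    ∫ w, Real.exp (-(Real.pi ^ 2 * ‖w‖ ^ 2 / b)) * φ w ≤ M := by
  have hbc : 0 < ((b : ℂ)).re := by simpa using hb
  let γ : V → ℂ := fun v => Complex.exp (-(b : ℂ) * (‖v‖ : ℂ) ^ 2)
  have hγr : ∀ v, γ v = (Real.exp (-b * ‖v‖ ^ 2) : ℝ) := fun v => by simp [γ]
  set c : ℝ := ∫ v : V, Real.exp (-b * ‖v‖ ^ 2) with hc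
  have hcpos : 0 < c := by
    rw [hc, GaussianFourier.integral_rexp_neg_mul_sq_norm hb]
    positivity
  -- The prefactor of the transformed Gaussian equals the mass `c` of the original one, so `c`
  -- appears on both sides of the estimate and cancels.
  have hcc : ((Real.pi : ℂ) / b) ^ (Module.finrank ℝ V / 2 : ℂ) = c := by
    rw [← GaussianFourier.integral_cexp_neg_mul_sq_norm hbc, hc, ← integral_complex_ofReal]
    exact integral_congr_ae (ae_of_all _ hγr)
  have hγi : Integrable γ := by
    refine (integrable_rexp_neg_mul_sq_norm hb).ofReal.congr (ae_of_all _ fun v => (hγr v).symm)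
  have hγ2 : MemLp γ 2 := memLp_two_of_integrable_of_bound hγi (M := 1) fun v => by
    rw [hγr, Complex.norm_real, Real.norm_of_nonneg (Real.exp_nonneg _)]
    exact Real.exp_le_one_iff.2 (by nlinarith [sq_nonneg ‖v‖])
  -- Parseval for `γ` and `C₀`: the frequency side is `c` times the Gaussian mean of `φ`, the space
  -- side is at most `M * c`.
  have hinner := Lp.inner_fourier_eq (hγ2.toLp γ) (hL.toLp C₀)
  rw [L2.inner_def, L2.inner_def] at hinner
  have hlhs : ∫ w, inner ℂ ((𝓕 (hγ2.toLp γ) : Lp ℂ 2 (volume : Measure V)) w)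
      ((𝓕 (hL.toLp C₀) : Lp ℂ 2 (volume : Measure V)) w) =
      ((c * ∫ w, Real.exp (-(Real.pi ^ 2 * ‖w‖ ^ 2 / b)) * φ w : ℝ) : ℂ) := by
    rw [← integral_const_mul, ← integral_complex_ofReal]
    refine integral_congr_ae ?_
    filter_upwards [fourier_toLp_ae_eq hγi hγ2, hφ] with w h1 h2
    rw [h1, h2, fourier_gaussian_innerProductSpace hbc, hcc, RCLike.inner_apply']
    have : Complex.exp (-(Real.pi : ℂ) ^ 2 * (‖w‖ : ℂ) ^ 2 / b) =
        (Real.exp (-(Real.pi ^ 2 * ‖w‖ ^ 2 / b)) : ℝ) := by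
      push_cast
      congr 1
      ring
    rw [this, ← Complex.ofReal_mul]
    simp only [Complex.conj_ofReal]
    push_cast
    ring
  have hrhs : ‖∫ v, inner ℂ (hγ2.toLp γ v) (hL.toLp C₀ v)‖ ≤ M * c := by
    rw [hc, ← integral_const_mul]
    refine norm_integral_le_of_norm_le ((integrable_rexp_neg_mul_sq_norm hb).const_mul M) ?_
    filter_upwards [hγ2.coeFn_toLp, hL.coeFn_toLp] with v h1 h2
    rw [h1, h2, hγr]
    refine (norm_inner_le_norm _ _).trans ?_
    rw [Complex.norm_real, Real.norm_of_nonneg (Real.exp_nonneg _), mul_comm]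
    exact mul_le_mul_of_nonneg_right (hM v) (Real.exp_nonneg _)
  rw [← hinner, hlhs, Complex.norm_real, Real.norm_of_nonneg] at hrhs
  · rw [mul_comm] at hrhs
    exact le_of_mul_le_mul_right hrhs hcpos
  · exact mul_nonneg hcpos.le
      (integral_nonneg fun w => mul_nonneg (Real.exp_nonneg _) (hφ0 w))

/-- A bounded nonnegative spectral density of a bounded function is integrable. -/
lemma integrable_spectralDensity {C₀ : V → ℂ} {M : ℝ} (hM : ∀ x, ‖C₀ x‖ ≤ M)
    (hL : MemLp C₀ 2) {φ : V → ℝ} (hφm : AEStronglyMeasurable φ) (hφ0 : ∀ x, 0 ≤ φ x)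
    (hφ1 : ∀ x, φ x ≤ 1)
    (hφ : (𝓕 (hL.toLp C₀) : Lp ℂ 2 (volume : Measure V)) =ᵐ[volume] fun x => (φ x : ℂ)) :
    Integrable φ := by
  refine ⟨hφm, ?_⟩
  rw [hasFiniteIntegral_iff_ofReal (ae_of_all _ hφ0)]
  -- Gaussian weights with `b = n + 1`, positive also at `n = 0`, tend pointwise to `1`; Fatou's
  -- lemma passes the uniform bound `M` to the integral of `φ`.
  let F : ℕ → V → ENNReal := fun n w =>
    ENNReal.ofReal (Real.exp (-(Real.pi ^ 2 * ‖w‖ ^ 2 / ((n : ℝ) + 1))) * φ w)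
  have hlim : ∀ w, Tendsto (fun n => F n w) atTop (𝓝 (ENNReal.ofReal (φ w))) := by
    intro w
    refine ENNReal.tendsto_ofReal ?_
    have h1 : Tendsto (fun n : ℕ => Real.pi ^ 2 * ‖w‖ ^ 2 / ((n : ℝ) + 1)) atTop (𝓝 0) :=
      tendsto_const_nhds.div_atTop
        (tendsto_atTop_add_const_right _ _ tendsto_natCast_atTop_atTop)
    have h2 := ((Real.continuous_exp.tendsto _).comp h1.neg).mul_const (φ w)
    simpa using! h2
  have hFm : ∀ n, AEMeasurable (F n) := fun n =>
    (((by fun_prop : Continuous fun w : V =>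
      Real.exp (-(Real.pi ^ 2 * ‖w‖ ^ 2 / ((n : ℝ) + 1)))).aestronglyMeasurable.mul
        hφm).aemeasurable).ennreal_ofReal
  have hle : ∀ n, ∫⁻ w, F n w ≤ ENNReal.ofReal M := by
    intro n
    have hn : (0 : ℝ) < (n : ℝ) + 1 := by positivity
    have hint : Integrable fun w : V =>
        Real.exp (-(Real.pi ^ 2 * ‖w‖ ^ 2 / ((n : ℝ) + 1))) * φ w := by
      refine Integrable.mul_bdd (c := 1) ?_ hφm (ae_of_all _ fun w => ?_)
      · refine (integrable_rexp_neg_mul_sq_norm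
          (b := Real.pi ^ 2 / ((n : ℝ) + 1)) (by positivity)).congr (ae_of_all _ fun w => ?_)
        simp only
        congr 1
        ring
      · rw [Real.norm_of_nonneg (hφ0 w)]
        exact hφ1 w
    rw [← ofReal_integral_eq_lintegral_ofReal hint
      (ae_of_all _ fun w => mul_nonneg (Real.exp_nonneg _) (hφ0 w))]
    exact ENNReal.ofReal_le_ofReal (integral_gaussian_mul_le hM hL hφ0 hφ hn)
  calc ∫⁻ w, ENNReal.ofReal (φ w) = ∫⁻ w, liminf (fun n => F n w) atTop := by
        simp_rw [fun w => (hlim w).liminf_eq]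
    _ ≤ liminf (fun n => ∫⁻ w, F n w) atTop := lintegral_liminf_le' hFm
    _ ≤ ENNReal.ofReal M := liminf_le_of_le (by isBoundedDefault)
        fun a ha => (ha.exists.elim fun n hn => hn.trans (hle n))
    _ < ⊤ := ENNReal.ofReal_lt_top

end SpectralDensity

/-! ### From a spectral density to the covariance and eigenvalue conditions. -/

section Sufficiency

open Filter Topology ComplexConjugate

lemma fourierChar_sub_eq {V : Type*} [NormedAddCommGroup V] [InnerProductSpace ℝ V] (v x y : V) :
    (Real.fourierChar (inner ℝ v (x - y)) : ℂ) =
      Real.fourierChar (inner ℝ v x) * conj (Real.fourierChar (inner ℝ v y) : ℂ) := by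
  rw [inner_sub_right, AddChar.map_sub_eq_div, Circle.coe_div, div_eq_mul_inv,
    ← Circle.coe_inv, Circle.coe_inv_eq_conj]

variable {V : Type*} [NormedAddCommGroup V] [InnerProductSpace ℝ V] [FiniteDimensional ℝ V]
  [MeasurableSpace V] [BorelSpace V]

/-- The inverse Fourier transform of a nonnegative integrable function is positive definite. -/
lemma isCovarianceFunction_fourierInv {φ : V → ℝ} (hφ : Integrable φ) (hφ0 : ∀ x, 0 ≤ φ x) :
    IsCovarianceFunction fun x y => 𝓕⁻ (fun v => (φ v : ℂ)) (x - y) := by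
  have hint : ∀ z : V, Integrable fun v => (Real.fourierChar (inner ℝ v z) : ℂ) * (φ v : ℂ) := by
    intro z
    refine hφ.ofReal.bdd_mul (c := 1) ?_ (ae_of_all _ fun v => (Circle.norm_coe _).le)
    have hcont : Continuous fun v : V => (Real.fourierChar (inner ℝ v z) : ℂ) := by fun_prop
    exact hcont.aestronglyMeasurable
  intro n x
  rw [Matrix.posSemidef_iff_dotProduct_mulVec]
  constructor
  · ext i j
    simp only [kernelMatrix, Matrix.conjTranspose_apply, Matrix.of_apply, Real.fourierInv_eq,
      Circle.smul_def, smul_eq_mul, ← starRingEnd_apply, ← integral_conj, map_mul,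
      Complex.conj_ofReal, fourierChar_sub_eq, Complex.conj_conj]
    refine integral_congr_ae (ae_of_all _ fun v => ?_)
    simp only
    ring
  · intro c
    -- The character of a difference factors, so the quadratic form becomes the integral of `φ |w|²`
    -- for this trigonometric sum.
    let w : V → ℂ := fun v => ∑ i, conj (c i) * Real.fourierChar (inner ℝ v (x i))
    have : star c ⬝ᵥ (kernelMatrix (fun x y => 𝓕⁻ (fun v => (φ v : ℂ)) (x - y)) x).mulVec c =
        ∫ v, ((φ v * ‖w v‖ ^ 2 : ℝ) : ℂ) := by
      simp only [dotProduct, Matrix.mulVec, kernelMatrix, Matrix.of_apply, Real.fourierInv_eq,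
        Circle.smul_def, smul_eq_mul, Finset.mul_sum, Pi.star_apply, ← integral_mul_const,
        ← integral_const_mul]
      have hint2 : ∀ i j, Integrable fun v => star (c i) *
          ((Real.fourierChar (inner ℝ v (x i - x j)) : ℂ) * (φ v : ℂ) * c j) := fun i j =>
        ((hint _).mul_const _).const_mul _
      simp_rw [← integral_finsetSum _ fun j _ => hint2 _ j]
      rw [← integral_finsetSum _ fun i _ => integrable_finsetSum _ fun j _ => hint2 i j]
      refine integral_congr_ae (ae_of_all _ fun v => ?_)
      simp only [Complex.ofReal_mul, Complex.ofReal_pow, ← Complex.mul_conj', w, map_sum,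
        map_mul, Complex.conj_conj, fourierChar_sub_eq]
      rw [Finset.sum_mul_sum, Finset.mul_sum]
      simp only [Finset.mul_sum]
      refine Finset.sum_congr rfl fun i _ => Finset.sum_congr rfl fun j _ => ?_
      rw [← starRingEnd_apply]
      ring
    rw [this, integral_complex_ofReal]
    exact_mod_cast integral_nonneg fun v => mul_nonneg (hφ0 v) (sq_nonneg _)

lemma fourierInv_comp_sub_left (g : V → ℂ) (x v : V) :
    𝓕⁻ (fun u => g (x - u)) v = Real.fourierChar (inner ℝ v x) • 𝓕 g v := by
  simp only [Real.fourierInv_eq, Real.fourier_eq]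
  rw [← integral_sub_left_eq_self _ volume x, Circle.smul_def, ← integral_smul]
  refine integral_congr_ae (ae_of_all _ fun y => ?_)
  simp only [sub_sub_cancel, ← Circle.smul_def, smul_smul, ← AddChar.map_add_eq_mul,
    ← sub_eq_add_neg, inner_sub_left, real_inner_comm v x]

/-- The multiplication formula moves the inverse transform onto the reflected translate of `g`,
which becomes a character times `𝓕 g`. -/
lemma integral_fourierInv_sub_mul {φ g : V → ℂ} (hφ : Integrable φ) (hg : Integrable g) (x : V) :
    ∫ y, 𝓕⁻ φ (x - y) * g y = 𝓕⁻ (fun v => φ v * 𝓕 g v) x := by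
  rw [← integral_sub_left_eq_self _ volume x]
  simp only [sub_sub_cancel]
  rw [integral_fourierInv_mul_eq hφ (hg.comp_sub_left x), Real.fourierInv_eq]
  refine integral_congr_ae (ae_of_all _ fun v => ?_)
  simp only [fourierInv_comp_sub_left, Circle.smul_def, smul_eq_mul]
  ring

/-- Spectral representation of the quadratic form of a stationary kernel. -/
lemma integral_conj_mul_integral_fourierInv_sub {φ : V → ℝ} (hφ : Integrable φ) {g : V → ℂ}
    (hg : Integrable g) :
    ∫ x, conj (g x) * ∫ y, 𝓕⁻ (fun v => (φ v : ℂ)) (x - y) * g y =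
      ((∫ v, φ v * ‖𝓕 g v‖ ^ 2 : ℝ) : ℂ) := by
  have hint : Integrable fun v => (φ v : ℂ) * 𝓕 g v :=
    hφ.ofReal.mul_bdd (c := ∫ x, ‖g x‖) (continuous_fourier hg).aestronglyMeasurable
      (ae_of_all _ fun v => VectorFourier.norm_fourierIntegral_le_integral_norm _ _ _ _ _)
  have hconv := fun x =>
    integral_fourierInv_sub_mul (φ := fun v => (φ v : ℂ)) hφ.ofReal hg x
  simp_rw [hconv]
  rw [← integral_conj_fourier_mul_eq hg hint, ← integral_complex_ofReal]
  refine integral_congr_ae (ae_of_all _ fun v => ?_)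
  simp only [Complex.ofReal_mul, Complex.ofReal_pow, ← Complex.mul_conj']
  ring

/-- Pairing the eigenvalue equation with the eigenfunction gives `c ‖h‖² = ∫ φ |𝓕 g|²`, where `g`
extends `h` by zero. Since `φ ≤ 1`, Plancherel bounds this by `‖h‖²`, which is positive. -/
lemma condC2_fourierInv {d : ℕ} {φ : EuclideanSpace ℝ (Fin d) → ℝ} (hφ : Integrable φ)
    (hφ1 : ∀ x, 0 ≤ φ x ∧ φ x ≤ 1) :
    CondC2 fun x y => 𝓕⁻ (fun v => (φ v : ℂ)) (x - y) := by
  rintro S hS c ⟨h, hh, hne, heig⟩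
  have hfin : IsFiniteMeasure (volume.restrict S) := ⟨by simpa using hS.measure_lt_top⟩
  have hSm := hS.measurableSet
  let g := S.indicator h
  have hg : Integrable g := (integrable_indicator_iff hSm).2 (hh.integrable (by norm_num))
  have hg2 : MemLp g 2 := (memLp_indicator_iff_restrict hSm).2 hh
  have hgy : ∀ x, ∫ y, 𝓕⁻ (fun v => (φ v : ℂ)) (x - y) * g y =
      ∫ y in S, 𝓕⁻ (fun v => (φ v : ℂ)) (x - y) * h y := by
    intro x
    rw [← integral_indicator hSm]
    refine integral_congr_ae (ae_of_all _ fun y => ?_)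
    by_cases hy : y ∈ S <;> simp [g, hy]
  have hI : ∫ x, ‖g x‖ ^ 2 = ∫ x in S, ‖h x‖ ^ 2 := by
    rw [← integral_indicator hSm]
    refine integral_congr_ae (ae_of_all _ fun y => ?_)
    by_cases hy : y ∈ S <;> simp [g, hy]
  have hQ : ∫ x, conj (g x) * ∫ y, 𝓕⁻ (fun v => (φ v : ℂ)) (x - y) * g y =
      ((c * ∫ x in S, ‖h x‖ ^ 2 : ℝ) : ℂ) := by
    rw [← integral_const_mul, ← integral_complex_ofReal]
    simp_rw [hgy]
    have : ∀ x, conj (g x) * ∫ y in S, 𝓕⁻ (fun v => (φ v : ℂ)) (x - y) * h y =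
        S.indicator (fun x => conj (h x) *
          ∫ y in S, 𝓕⁻ (fun v => (φ v : ℂ)) (x - y) * h y) x := by
      intro x
      by_cases hx : x ∈ S <;> simp [g, hx]
    simp_rw [this]
    rw [integral_indicator hSm]
    refine integral_congr_ae ?_
    filter_upwards [heig] with x hx
    rw [hx]
    simp only [Complex.ofReal_mul, Complex.ofReal_pow, ← Complex.mul_conj']
    ring
  rw [integral_conj_mul_integral_fourierInv_sub hφ hg] at hQ
  have hQ' := Complex.ofReal_injective hQ
  obtain ⟨hmem, hpl⟩ := integral_norm_sq_fourier_eq hg hg2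
  have hle : ∫ v, φ v * ‖𝓕 g v‖ ^ 2 ≤ ∫ v, ‖𝓕 g v‖ ^ 2 := by
    refine integral_mono_of_nonneg (ae_of_all _ fun v => mul_nonneg (hφ1 v).1 (sq_nonneg _))
      ((memLp_two_iff_integrable_sq_norm hmem.aestronglyMeasurable).1 hmem)
      (ae_of_all _ fun v => mul_le_of_le_one_left (sq_nonneg _) (hφ1 v).2)
  rw [hQ', hpl, hI] at hle
  have hpos : 0 < ∫ x in S, ‖h x‖ ^ 2 := by
    refine lt_of_le_of_ne (integral_nonneg fun x => sq_nonneg _) fun h0 => hne ?_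
    have := (integral_eq_zero_iff_of_nonneg (fun x => sq_nonneg ‖h x‖)
      ((memLp_two_iff_integrable_sq_norm hh.aestronglyMeasurable).1 hh)).1 h0.symm
    filter_upwards [this] with x hx
    simpa using hx
  exact le_of_mul_le_mul_right (by simpa using hle) hpos

end Sufficiency

/-! ### Construction of the density from the two conditions, and the equivalence. -/

open ComplexConjugate in
/-- A square integrable stationary kernel satisfying both conditions has a spectral density
between zero and one. -/
lemma exists_spectralDensity {d : ℕ}
    {C : EuclideanSpace ℝ (Fin d) → EuclideanSpace ℝ (Fin d) → ℂ}
    {C₀ : EuclideanSpace ℝ (Fin d) → ℂ} (hstat : ∀ x y, C x y = C₀ (x - y))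
    (hC1 : CondC1 C) (hC2 : CondC2 C) (hL : MemLp C₀ 2 volume) :
    ∃ φ : EuclideanSpace ℝ (Fin d) → ℝ,
        Integrable φ volume ∧ (∀ x, 0 ≤ φ x ∧ φ x ≤ 1) ∧
        C₀ = 𝓕⁻ (fun x => (φ x : ℂ)) := by
  have hM₀ := hC1.2.norm_le_of_stationary hstat
  set M := (C₀ 0).re
  have hM : ∀ x y, ‖C x y‖ ≤ M := fun x y => by rw [hstat]; exact hM₀ _
  have hC₀ : Continuous C₀ := by
    have h : Continuous fun x : EuclideanSpace ℝ (Fin d) => C x 0 :=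
      hC1.1.comp (continuous_id.prodMk continuous_const)
    simpa [hstat] using h
  set Φ : Lp ℂ 2 (volume : Measure (EuclideanSpace ℝ (Fin d))) := 𝓕 (hL.toLp C₀) with hΦ
  have hΦl : LocallyIntegrable Φ := (Lp.memLp Φ).locallyIntegrable (by norm_num)
  have h0 : ∀ᵐ x, 0 ≤ Φ x := by
    refine ae_nonneg_of_forall_integral_sq_mul_nonneg hΦl fun g hg hgc => ?_
    obtain ⟨f, -, hf⟩ := exists_integral_sq_mul_fourier_eq hC₀ hM₀ hL hg hgc
    rw [hf]
    simp_rw [← hstat]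
    exact hC1.2.integral_nonneg hC1.1 hM f.integrable
  -- Tested against `g²`, this is `‖f‖₂²` minus the quadratic form of `f = 𝓕⁻ g`, which (C2) makes
  -- nonnegative.
  have h1 : ∀ᵐ x, 0 ≤ 1 - Φ x := by
    refine ae_nonneg_of_forall_integral_sq_mul_nonneg
      ((locallyIntegrable_const 1).sub hΦl) fun g hg hgc => ?_
    obtain ⟨f, hfn, hf⟩ := exists_integral_sq_mul_fourier_eq hC₀ hM₀ hL hg hgc
    have hc2 : HasCompactSupport fun x => (g x) ^ 2 :=
      hgc.comp_left (g := fun t : ℝ => t ^ 2) (by simp)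
    have hsq : Integrable fun x => (g x) ^ 2 :=
      (hg.continuous.pow 2).integrable_of_hasCompactSupport hc2
    have hprod : Integrable fun x => (((g x) ^ 2 : ℝ) : ℂ) * Φ x := by
      have := hΦl.integrable_smul_left_of_hasCompactSupport (g := fun x => (g x) ^ 2)
        (hg.continuous.pow 2) hc2
      simpa only [Complex.real_smul] using this
    have hsqc : Integrable fun x => (((g x) ^ 2 : ℝ) : ℂ) := hsq.ofReal
    simp only [mul_sub, mul_one]
    rw [integral_sub hsqc hprod, hf, integral_complex_ofReal, ← hfn]
    simp_rw [← hstat]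
    have hpos := hC1.2.integral_nonneg hC1.1 hM (f.integrable (μ := volume))
    have hle := norm_integral_kernel_le hC1 hC2 hM f.integrable (f.memLp 2 volume)
    rw [sub_nonneg]
    rw [Complex.le_def] at hpos ⊢
    refine ⟨(Complex.re_le_norm _).trans hle, hpos.2.symm⟩
  -- `Φ` lies in `[0, 1]` only almost everywhere; truncation gives the bounds at every point without
  -- changing its class.
  let φ : EuclideanSpace ℝ (Fin d) → ℝ := fun x => max 0 (min 1 (Φ x).re)
  have hφ0 : ∀ x, 0 ≤ φ x := fun x => le_max_left _ _
  have hφ1 : ∀ x, φ x ≤ 1 := fun x => max_le zero_le_one (min_le_left _ _)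
  have hΦm : AEStronglyMeasurable (fun x => (Φ x).re) :=
    Complex.continuous_re.comp_aestronglyMeasurable (Lp.aestronglyMeasurable Φ)
  have hφm : AEStronglyMeasurable φ :=
    aestronglyMeasurable_const.sup (aestronglyMeasurable_const.inf hΦm)
  have hae : Φ =ᵐ[volume] fun x => (φ x : ℂ) := by
    filter_upwards [h0, h1] with x hx0 hx1
    rw [Complex.le_def] at hx0 hx1
    have hx1' : (Φ x).re ≤ 1 := by simpa using hx1.1
    refine Complex.ext ?_ ?_
    · simp only [φ, Complex.ofReal_re, min_eq_right hx1']
      exact (max_eq_right hx0.1).symm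
    · simpa using hx0.2.symm
  have hφi := integrable_spectralDensity hM₀ hL hφm hφ0 hφ1 hae
  refine ⟨φ, hφi, fun x => ⟨hφ0 x, hφ1 x⟩, ?_⟩
  have hφ2 : MemLp (fun x => (φ x : ℂ)) 2 := (memLp_congr_ae hae).1 (Lp.memLp Φ)
  have hΦφ : Φ = hφ2.toLp _ := Lp.ext (hae.trans hφ2.coeFn_toLp.symm)
  have hinv : 𝓕⁻ Φ = hL.toLp C₀ := FourierTransform.fourierInv_fourier_eq _
  have hφc : Integrable fun x => (φ x : ℂ) := hφi.ofReal
  -- Inversion in `L²` gives equality almost everywhere; continuity of both sides, the right one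
  -- because `φ` is integrable, makes it hold everywhere.
  rw [← Continuous.ae_eq_iff_eq volume hC₀ (continuous_fourierInv hφc)]
  have h := fourierInv_toLp_ae_eq hφc hφ2
  rw [← hΦφ, hinv] at h
  exact hL.coeFn_toLp.symm.trans h

end DPP

theorem corollary3p2 {d : ℕ}
    (C : EuclideanSpace ℝ (Fin d) → EuclideanSpace ℝ (Fin d) → ℂ)
    (C₀ : EuclideanSpace ℝ (Fin d) → ℂ)
    (hstat : ∀ x y, C x y = C₀ (x - y)) :
    (∃ φ : EuclideanSpace ℝ (Fin d) → ℝ,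
        Integrable φ volume ∧ (∀ x, 0 ≤ φ x ∧ φ x ≤ 1) ∧
        C₀ = 𝓕⁻ (fun x => (φ x : ℂ))) ↔
      (DPP.CondC1 C ∧ DPP.CondC2 C ∧ MemLp C₀ 2 volume) := by
  constructor
  · rintro ⟨φ, hφ, hφ1, hC₀⟩
    have hC : C = fun x y => 𝓕⁻ (fun v => (φ v : ℂ)) (x - y) := by
      funext x y
      rw [hstat, hC₀]
    have hφ2 : MemLp (fun x => (φ x : ℂ)) 2 volume :=
      DPP.memLp_two_of_integrable_of_bound hφ.ofReal (M := 1) fun x => by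
        rw [Complex.norm_real, Real.norm_of_nonneg (hφ1 x).1]
        exact (hφ1 x).2
    refine ⟨⟨?_, ?_⟩, ?_, ?_⟩
    · rw [hC]
      exact (DPP.continuous_fourierInv hφ.ofReal).comp (continuous_fst.sub continuous_snd)
    · rw [hC]
      exact DPP.isCovarianceFunction_fourierInv hφ fun x => (hφ1 x).1
    · rw [hC]
      exact DPP.condC2_fourierInv hφ hφ1
    · rw [hC₀]
      exact (memLp_congr_ae (DPP.fourierInv_toLp_ae_eq hφ.ofReal hφ2)).1 (Lp.memLp _)
  · rintro ⟨hC1, hC2, hL⟩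
    exact DPP.exists_spectralDensity hstat hC1 hC2 hL
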